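/- Let $n\ge 0$ and $d\ge 1$ be integers. A state of $n$ qudits is a family of complex numbers $c_{i_1\cdots i_n}$, $1\le i_1,\dots,i_n\le d$, with $\sum|c_{i_1\cdots i_n}|^2=1$. The reduced density matrix $\rho^{(a)}$ of the $a$-th qudit ($1\le a\le n$) is the $d\times d$ matrix whose $(i,i')$ entry is the sum, over all indices other than the $a$-th one, of $c_{\cdots i\cdots}\,\overline{c_{\cdots i'\cdots}}$, where $i$ and $i'$ stand in the $a$-th place. An eigenvalue point is a point $\lambda=(\lambda_i^{(a)})_{1\le a\le n,\ 1\le i\le d-1}$ of the $n(d-1)$-dimensional Euclidean space; one puts $\lambda_d^{(a)}=1-\sum_{i=1}^{d-1}\lambda_i^{(a)}$. It is called realisable if there is a state such that, for every $a$, $\lambda_1^{(a)}\le\lambda_2^{(a)}\le\cdots\le\lambda_d^{(a)}$ are the eigenvalues of $\rho^{(a)}$, counted with multiplicity. For an $n$-tuple $[i_1\cdots i_n]\in\{1,\dots,d\}^n$ the lattice eigenvalue point $L_{i_1\cdots i_n}$ is given by $\lambda_{i_a}^{(a)}=1$ for all $a$ and $\lambda_i^{(a)}=0$ for $i\ne i_a$.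 For a set $N$ of such $n$-tuples let $$V_N=\Big\{\sum_{t\in N}A_tL_t\;:\;0\le A_t\le 1,\ \sum_{t\in N}A_t=1\Big\}.$$ Proposition. Let $U$ be a non-empty open set in the $n(d-1)$-dimensional space of eigenvalue points such that no eigenvalues are degenerate in $U$, i.e. for every $\lambda\in U$ and every $a$ the numbers $\lambda_1^{(a)},\dots,\lambda_d^{(a)}$ are pairwise distinct. Let $f$ be a real-valued function that is differentiable on $U$ with a gradient that is continuous and nowhere zero on $U$. Suppose that a point $\lambda\in U$ is realisable if and only if $f(\lambda)\ge 0$, and that the hypersurface $\{\lambda\in U: f(\lambda)=0\}$ is connected (it may be empty). Then there is a set $N$ of $n$-tuples such that the affine span of $V_N$, i.e. of the lattice eigenvalue points $L_{i_1\cdots i_n}$ with $[i_1\cdots i_n]\in N$, is a hyperplane (an affine subspace of codimension one) and $$\{\lambda\in U: f(\lambda)=0\}\subseteq V_N .$$ -/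

import Mathlib

open Polynomial

noncomputable section

namespace Qudit

/-- The coefficients `c_{i₁ … iₙ}` of a vector of `n` qudits of local dimension `d = k + 1`, with
respect to the product basis. The levels `1, …, d` of the text are the elements
`0, …, k` of `Fin (k + 1)`. -/
abbrev Coeffs (n k : ℕ) : Type := (Fin n → Fin (k + 1)) → ℂ

/-- A (pure) state is a normalised vector. -/
def IsState {n k : ℕ} (c : Coeffs n k) : Prop := ∑ t, ‖c t‖ ^ 2 = 1

/-- The one-particle reduced density matrix of the `a`-th qudit: the sum, over all indices other
than the `a`-th one, of `c_{… i …}` times the conjugate of `c_{… i' …}`. -/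
def rdm {n k : ℕ} (c : Coeffs n k) (a : Fin n) : Matrix (Fin (k + 1)) (Fin (k + 1)) ℂ :=
  Matrix.of fun i i' =>
    ∑ t : Fin n → Fin (k + 1) with t a = i, c t * star (c (Function.update t a i'))

/-- The `n (d - 1)`-dimensional Euclidean space of eigenvalue points, with the coordinates
`λ_i^{(a)}` for `1 ≤ a ≤ n` and `1 ≤ i ≤ d - 1`. -/
abbrev EPoint (n k : ℕ) : Type := EuclideanSpace ℝ (Fin n × Fin k)

/-- All `d` numbers `λ_1^{(a)}, …, λ_d^{(a)}` belonging to an eigenvalue point, the last of them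
being determined by `∑ i, λ_i^{(a)} = 1`. -/
def EPoint.eig {n k : ℕ} (lam : EPoint n k) (a : Fin n) : Fin (k + 1) → ℝ :=
  Fin.snoc (α := fun _ => ℝ) (fun i : Fin k => lam (a, i)) (1 - ∑ i : Fin k, lam (a, i))

/-- An eigenvalue point is realisable if there is a state such that, for every `a`, the number
`λ_i^{(a)}` is the `i`-th smallest eigenvalue (counted with multiplicity) of the reduced density
matrix of the `a`-th qudit. -/
def EPoint.Realisable {n k : ℕ} (lam : EPoint n k) : Prop :=
  ∃ c : Coeffs n k, IsState c ∧ ∀ a : Fin n,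
    Monotone (lam.eig a) ∧ (rdm c a).charpoly = ∏ i, (X - C ((lam.eig a i : ℝ) : ℂ))

/-- No two of the eigenvalues of one and the same qudit coincide. -/
def EPoint.Nondegenerate {n k : ℕ} (lam : EPoint n k) : Prop :=
  ∀ a : Fin n, Function.Injective (lam.eig a)

/-- The lattice eigenvalue point `L_{i₁ … iₙ}`: `λ_{i_a}^{(a)} = 1` for every `a`, and
`λ_i^{(a)} = 0` for `i ≠ i_a`. -/
def latticePoint {n k : ℕ} (t : Fin n → Fin (k + 1)) : EPoint n k :=
  WithLp.toLp 2 fun p => if t p.1 = p.2.castSucc then 1 else 0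

/-- The convex set `V_N` of all combinations `∑ A_t L_t` over `t ∈ N` with `0 ≤ A_t ≤ 1` and
`∑ A_t = 1`. -/
def latticeHull {n k : ℕ} (N : Finset (Fin n → Fin (k + 1))) : Set (EPoint n k) :=
  {lam | ∃ A : (Fin n → Fin (k + 1)) → ℝ,
    (∀ t ∈ N, 0 ≤ A t ∧ A t ≤ 1) ∧ ∑ t ∈ N, A t = 1 ∧ lam = ∑ t ∈ N, A t • latticePoint t}

/-- An affine hyperplane: the solution set of one linear equation with nonzero left-hand side. -/
def IsHyperplane {n k : ℕ} (H : Set (EPoint n k)) : Prop :=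
  ∃ (φ : EPoint n k →ₗ[ℝ] ℝ) (v : ℝ), φ ≠ 0 ∧ H = {lam | φ lam = v}

end Qudit

end

noncomputable section

namespace Qudit

/-! Local step. Let `f lam = 0`. Local unitaries make all reduced density matrices of a realising
state `c` diagonal, so `lam = ∑ ‖c t‖² • L_t`. Multiply each `c t` by a real factor `r t` near `1`,
keeping the norm, and let the eigenvalue point follow. Every point reached is realisable, so `f` has
a minimum at `(1, lam)` on this constraint set. The Lagrange conditions say `⟪∇f, L_t⟫ = ⟪∇f, lam⟫`
whenever `c t ≠ 0`: the lattice points in the support lie in the tangent hyperplane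
(`exists_mem_latticeHull_of_realisable_iff`).

Global step. Zeros lying on no lattice span of codimension at least two are dense in the zero set
(`exists_zero_notMem_of_gradient_ne_zero`). At such a zero the support must span the whole tangent
hyperplane. The finitely many candidate hyperplanes therefore cut the zero set into closed pieces;
these are disjoint, because the gradient determines the hyperplane. Connectedness leaves one piece
(`exists_isHyperplane_of_mem_latticeHull`). -/

/-! ### Affine geometry -/

/-- An affine subspace that becomes everything after adding one point, and lies in a hyperplane,
is that hyperplane. -/
theorem eq_hyperplane_of_affineSpan_insert_eq_top {E : Type*} [AddCommGroup E] [Module ℝ E]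
    {A : AffineSubspace ℝ E} {p : E} (hp : affineSpan ℝ (insert p (A : Set E)) = ⊤)
    (hne : (A : Set E).Nonempty) {φ : E →ₗ[ℝ] ℝ} (hφ : φ ≠ 0) {v : ℝ}
    (hA : ∀ x ∈ A, φ x = v) : (A : Set E) = {x | φ x = v} := by
  obtain ⟨q, hq⟩ := hne
  have key : ∀ x : E, ∃ r : ℝ, ∃ p₀ ∈ A, x = r • (p - q) + p₀ := by
    intro x
    have hx : x ∈ affineSpan ℝ (insert p (A : Set E)) := hp ▸ AffineSubspace.mem_top ℝ E x
    simpa using (AffineSubspace.mem_affineSpan_insert_iff hq p x).1 hx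
  have hpv : φ p ≠ v := by
    intro h
    have hconst : ∀ x, φ x = v := by
      intro x
      obtain ⟨r, p₀, hp₀, rfl⟩ := key x
      simp [hA p₀ hp₀, hA q hq, h]
    have hv : v = 0 := by simpa using (hconst 0).symm
    exact hφ (LinearMap.ext fun x => by simpa [hv] using hconst x)
  refine Set.Subset.antisymm hA fun x hx => ?_
  obtain ⟨r, p₀, hp₀, rfl⟩ := key x
  have hx' : r * (φ p - v) + v = v := by simpa [hA p₀ hp₀, hA q hq] using hx
  have hr : r = 0 := by
    have : r * (φ p - v) = 0 := by linarith
    exact (mul_eq_zero.1 this).resolve_right (sub_ne_zero.2 hpv)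
  simpa [hr] using hp₀

/-- A regular zero of a function can be approximated by zeros that avoid finitely many affine
subspaces of codimension at least two. -/
theorem exists_zero_notMem_of_gradient_ne_zero {E : Type*} [NormedAddCommGroup E]
    [InnerProductSpace ℝ E] [FiniteDimensional ℝ E] {ι : Type*} (s : Finset ι)
    (A : ι → AffineSubspace ℝ E)
    (hA : ∀ i ∈ s, ∀ p, affineSpan ℝ (insert p (A i : Set E)) ≠ ⊤)
    {U : Set E} (hU : IsOpen U) {f : E → ℝ} (hf : ContinuousOn f U) {x₀ : E} (hx₀ : x₀ ∈ U)
    (hf₀ : f x₀ = 0) (hg : gradient f x₀ ≠ 0) {W : Set E} (hW : W ∈ nhds x₀) :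
    ∃ x ∈ W ∩ U, f x = 0 ∧ ∀ i ∈ s, x ∉ A i := by
  obtain ⟨δ, hδ, hball⟩ := Metric.mem_nhds_iff.1 (Filter.inter_mem hW (hU.mem_nhds hx₀))
  have hfd : fderiv ℝ f x₀ ≠ 0 := fun h => hg (by simp [gradient, h])
  have hmem := Metric.ball_mem_nhds x₀ hδ
  have hminus : ∃ p ∈ Metric.ball x₀ δ, f p < 0 := by
    by_contra! h
    exact hfd (IsLocalMin.fderiv_eq_zero (Filter.mem_of_superset hmem fun x hx => by
      simpa [hf₀] using h x hx))
  have hplus : ∃ p ∈ Metric.ball x₀ δ, 0 < f p := by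
    by_contra! h
    exact hfd (IsLocalMax.fderiv_eq_zero (Filter.mem_of_superset hmem fun x hx => by
      simpa [hf₀] using h x hx))
  -- Choose `q` with `0 < f q` outside the cones with apex `p` over the `A i`, which are null sets
  -- since each `A i` has codimension at least two. A zero on the segment from `p` to `q` then
  -- avoids every `A i`: otherwise the line through `p` and that zero would put `q` in a cone.
  obtain ⟨p, hp, hfp⟩ := hminus
  have hfB : ContinuousOn f (Metric.ball x₀ δ) := hf.mono fun x hx => (hball hx).2
  let _ : MeasurableSpace E := borel E
  have _ : BorelSpace E := ⟨rfl⟩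
  let μ : MeasureTheory.Measure E := MeasureTheory.Measure.addHaar
  have hopen : IsOpen (Metric.ball x₀ δ ∩ f ⁻¹' Set.Ioi 0) :=
    hfB.isOpen_inter_preimage Metric.isOpen_ball isOpen_Ioi
  have hpos : 0 < μ (Metric.ball x₀ δ ∩ f ⁻¹' Set.Ioi 0) :=
    hopen.measure_pos μ hplus
  have hnull : μ (⋃ i ∈ s, (affineSpan ℝ (insert p (A i : Set E)) : Set E)) = 0 := by
    refine (MeasureTheory.measure_biUnion_null_iff (I := (s : Set ι)) s.countable_toSet).2 ?_
    exact fun i hi => MeasureTheory.Measure.addHaar_affineSubspace μ _ (hA i hi p)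
  obtain ⟨q, ⟨hqB, hfq⟩, hq⟩ : ∃ q ∈ Metric.ball x₀ δ ∩ f ⁻¹' Set.Ioi 0,
      q ∉ ⋃ i ∈ s, (affineSpan ℝ (insert p (A i : Set E)) : Set E) := by
    by_contra! h
    exact hpos.ne' (MeasureTheory.measure_mono_null h hnull)
  have hseg : segment ℝ p q ⊆ Metric.ball x₀ δ := (convex_ball x₀ δ).segment_subset hp hqB
  obtain ⟨x, hx, hfx⟩ := (convex_segment (𝕜 := ℝ) p q).isPreconnected.intermediate_value
    (left_mem_segment ℝ p q) (right_mem_segment ℝ p q) (hfB.mono hseg)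
    (show (0 : ℝ) ∈ Set.Icc (f p) (f q) from ⟨hfp.le, le_of_lt hfq⟩)
  refine ⟨x, hball (hseg hx), hfx, fun i hi hxA => hq ?_⟩
  rw [segment_eq_image_lineMap] at hx
  obtain ⟨θ, -, rfl⟩ := hx
  have hθ : θ ≠ 0 := by
    rintro rfl
    simp only [AffineMap.lineMap_apply_zero] at hfx
    exact hfp.ne hfx
  refine Set.mem_iUnion₂.2 ⟨i, hi, ?_⟩
  have h1 : p ∈ affineSpan ℝ (insert p (A i : Set E)) :=
    subset_affineSpan ℝ _ (Set.mem_insert _ _)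
  have h2 : AffineMap.lineMap p q θ ∈ affineSpan ℝ (insert p (A i : Set E)) :=
    subset_affineSpan ℝ _ (Set.mem_insert_of_mem _ hxA)
  have h3 := AffineMap.lineMap_mem θ⁻¹ h1 h2
  have h4 : AffineMap.lineMap p (AffineMap.lineMap p q θ : E) θ⁻¹ = q := by
    simp [AffineMap.lineMap_apply, smul_smul, inv_mul_cancel₀ hθ]
  rwa [h4] at h3

/-! ### Lattice points -/

variable {n k : ℕ}

/-- The bounds `A t ≤ 1` follow from nonnegativity and total weight one. -/
theorem latticeHull_eq_convexHull (N : Finset (Fin n → Fin (k + 1))) :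
    latticeHull N = convexHull ℝ (latticePoint '' (N : Set (Fin n → Fin (k + 1)))) := by
  refine Set.Subset.antisymm ?_ (convexHull_min ?_ ?_)
  · rintro _ ⟨A, hA, hsum, rfl⟩
    exact (convex_convexHull ℝ _).sum_mem (fun t ht => (hA t ht).1) hsum fun t ht =>
      subset_convexHull ℝ _ ⟨t, ht, rfl⟩
  · rintro _ ⟨t, ht, rfl⟩
    have ht' : t ∈ N := ht
    refine ⟨Pi.single t 1, fun u _ => ?_, ?_, ?_⟩
    · by_cases h : u = t <;> simp [h]
    · simp [Finset.sum_pi_single', ht']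
    · simp [Pi.single_apply, ht', ite_smul]
  · rintro _ ⟨A, hA, hAs, rfl⟩ _ ⟨B, hB, hBs, rfl⟩ a b ha hb hab
    have hs : ∑ t ∈ N, (a * A t + b * B t) = 1 := by
      rw [Finset.sum_add_distrib, ← Finset.mul_sum, ← Finset.mul_sum, hAs, hBs]
      simpa using hab
    have h0 : ∀ t ∈ N, 0 ≤ a * A t + b * B t := fun t ht =>
      add_nonneg (mul_nonneg ha (hA t ht).1) (mul_nonneg hb (hB t ht).1)
    refine ⟨fun t => a * A t + b * B t, fun t ht => ⟨h0 t ht, ?_⟩, hs, ?_⟩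
    · exact hs ▸ Finset.single_le_sum h0 ht
    · simp only [Finset.smul_sum, smul_smul, add_smul, Finset.sum_add_distrib]

theorem affineSpan_latticeHull (N : Finset (Fin n → Fin (k + 1))) :
    affineSpan ℝ (latticeHull N) =
      affineSpan ℝ (latticePoint '' (N : Set (Fin n → Fin (k + 1)))) := by
  rw [latticeHull_eq_convexHull]
  exact affineSpan_convexHull _

theorem isClosed_latticeHull (N : Finset (Fin n → Fin (k + 1))) : IsClosed (latticeHull N) := by
  rw [latticeHull_eq_convexHull]
  exact ((N.finite_toSet.image _).isCompact_convexHull ℝ).isClosed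

/-- With every index at the last level the lattice point is the origin; changing one index gives a
standard basis vector. -/
theorem affineSpan_range_latticePoint :
    affineSpan ℝ (Set.range (latticePoint : (Fin n → Fin (k + 1)) → EPoint n k)) = ⊤ := by
  have h0 : latticePoint (fun _ => Fin.last k) = (0 : EPoint n k) := by
    ext p
    simp [latticePoint, (Fin.castSucc_lt_last _).ne']
  have hb : ∀ p : Fin n × Fin k, latticePoint
      (Function.update (fun _ => Fin.last k) p.1 p.2.castSucc) = EuclideanSpace.single p (1 : ℝ) := by
    rintro ⟨a, i⟩
    ext ⟨b, j⟩
    by_cases hab : b = a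
    · subst hab
      simp [latticePoint, eq_comm]
    · simp [latticePoint, hab, (Fin.castSucc_lt_last _).ne']
  set A := affineSpan ℝ (Set.range (latticePoint : (Fin n → Fin (k + 1)) → EPoint n k))
  have hmem : ∀ t, (latticePoint t : EPoint n k) ∈ A := fun t =>
    subset_affineSpan ℝ _ (Set.mem_range_self t)
  have h0A : (0 : EPoint n k) ∈ A := h0 ▸ hmem _
  have hdir : ∀ p : Fin n × Fin k, EuclideanSpace.single p (1 : ℝ) ∈ A.direction := fun p => by
    rw [← hb p]
    simpa using AffineSubspace.vsub_mem_direction (hmem _) h0A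
  refine eq_top_iff.2 fun x _ => ?_
  have hx : x ∈ A.direction := by
    rw [← (EuclideanSpace.basisFun (Fin n × Fin k) ℝ).sum_repr x]
    exact Submodule.sum_mem _ fun p _ => Submodule.smul_mem _ _ (by simpa using hdir p)
  simpa using AffineSubspace.vadd_mem_of_mem_direction hx h0A

/-- Some set of lattice points spans a hyperplane, if there is room for one. -/
theorem exists_isHyperplane_affineSpan_latticeHull [Nontrivial (EPoint n k)] :
    ∃ N : Finset (Fin n → Fin (k + 1)),
      IsHyperplane (affineSpan ℝ (latticeHull N) : Set (EPoint n k)) := by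
  classical
  -- A maximal set of lattice points with proper span works: one more lattice point makes the span
  -- everything.
  let s : Finset (Finset (Fin n → Fin (k + 1))) := Finset.univ.filter fun N =>
    affineSpan ℝ (latticePoint '' (N : Set (Fin n → Fin (k + 1)))) ≠ (⊤ : AffineSubspace ℝ (EPoint n k))
  have hs : s.Nonempty := ⟨∅, by simp [s, (AffineSubspace.bot_ne_top ℝ (EPoint n k) (EPoint n k))]⟩
  obtain ⟨N, hN⟩ := s.exists_maximal hs
  have hNtop := (Finset.mem_filter.1 hN.prop).2
  obtain ⟨t, ht⟩ : ∃ t, t ∉ N := by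
    by_contra! h
    apply hNtop
    have : (N : Set (Fin n → Fin (k + 1))) = Set.univ := Set.eq_univ_of_forall h
    rw [this, Set.image_univ, affineSpan_range_latticePoint]
  have hins : affineSpan ℝ (latticePoint '' ((insert t N : Finset _) : Set (Fin n → Fin (k + 1)))) =
      (⊤ : AffineSubspace ℝ (EPoint n k)) := by
    by_contra h
    have hmem : insert t N ∈ s := Finset.mem_filter.2 ⟨Finset.mem_univ _, h⟩
    exact ht (hN.2 hmem (Finset.subset_insert t N) (Finset.mem_insert_self t N))
  rw [Finset.coe_insert, Set.image_insert_eq] at hins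
  refine ⟨N, ?_⟩
  rw [affineSpan_latticeHull]
  set A := affineSpan ℝ (latticePoint '' (N : Set (Fin n → Fin (k + 1)))) with hAdef
  have hA : affineSpan ℝ (insert (latticePoint t) (A : Set (EPoint n k))) = ⊤ := by
    rw [hAdef, affineSpan_insert_affineSpan, hins]
  have hne : (A : Set (EPoint n k)).Nonempty := by
    by_contra h
    rw [Set.not_nonempty_iff_eq_empty] at h
    rw [h] at hA
    obtain ⟨x, hx⟩ := exists_ne (latticePoint t : EPoint n k)
    have : x ∈ affineSpan ℝ (insert (latticePoint t) (∅ : Set (EPoint n k))) :=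
      hA ▸ AffineSubspace.mem_top ℝ _ x
    simp [hx] at this
  obtain ⟨q, hq⟩ := hne
  have hdir : A.direction < ⊤ := lt_top_iff_ne_top.2 fun h =>
    hNtop ((AffineSubspace.direction_eq_top_iff_of_nonempty ⟨q, hq⟩).1 h)
  obtain ⟨φ, hφ, hker⟩ := Submodule.exists_le_ker_of_lt_top _ hdir
  refine ⟨φ, φ q, hφ, eq_hyperplane_of_affineSpan_insert_eq_top hA ⟨q, hq⟩ hφ fun x hx => ?_⟩
  have := hker (AffineSubspace.vsub_mem_direction hx hq)
  simpa [sub_eq_zero] using this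

/-- If every point of a regular connected level set is a convex combination of lattice points lying
in the tangent hyperplane, then the level set lies in a single hyperplane spanned by lattice
points. -/
theorem exists_isHyperplane_of_mem_latticeHull [Nontrivial (EPoint n k)] {U : Set (EPoint n k)}
    {f : EPoint n k → ℝ} (hU : IsOpen U) (hdiff : DifferentiableOn ℝ f U)
    (hcont : ContinuousOn (gradient f) U) (hgrad : ∀ x ∈ U, gradient f x ≠ 0)
    (hconn : IsPreconnected {x ∈ U | f x = 0})
    (hsupp : ∀ x ∈ U, f x = 0 → ∃ N : Finset (Fin n → Fin (k + 1)), x ∈ latticeHull N ∧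
      ∀ t ∈ N, inner ℝ (gradient f x) (latticePoint t) = inner ℝ (gradient f x) x) :
    ∃ N : Finset (Fin n → Fin (k + 1)),
      IsHyperplane (affineSpan ℝ (latticeHull N) : Set (EPoint n k)) ∧
      {x ∈ U | f x = 0} ⊆ latticeHull N := by
  classical
  set S := {x ∈ U | f x = 0}
  rcases S.eq_empty_or_nonempty with hSe | ⟨x₁, hx₁⟩
  · obtain ⟨N, hN⟩ := exists_isHyperplane_affineSpan_latticeHull (n := n) (k := k)
    exact ⟨N, hN, by simp [hSe]⟩
  let A : Finset (Fin n → Fin (k + 1)) → AffineSubspace ℝ (EPoint n k) := fun N =>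
    affineSpan ℝ (latticePoint '' (N : Set (Fin n → Fin (k + 1))))
  have hLA : ∀ N, ∀ t ∈ N, latticePoint t ∈ A N := fun N t ht =>
    subset_affineSpan ℝ _ ⟨t, ht, rfl⟩
  have hhull : ∀ N, latticeHull N ⊆ A N := fun N => by
    simpa [A, ← affineSpan_latticeHull] using subset_affineSpan ℝ (latticeHull N)
  let T : Finset (Fin n → Fin (k + 1)) → Set S := fun N => {x | x.1 ∈ latticeHull N ∧
    ∀ t ∈ N, inner ℝ (gradient f x.1) (latticePoint t) = inner ℝ (gradient f x.1) x.1}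
  -- Codimension at most one, and saturated: `N` contains every lattice point of its span, so the
  -- span determines `N`. The full space is not excluded here, but `hTA` shows that `T N` is then
  -- empty.
  let F : Finset (Finset (Fin n → Fin (k + 1))) := Finset.univ.filter fun N =>
    (∃ p, affineSpan ℝ (insert p (A N : Set (EPoint n k))) = ⊤) ∧
      ∀ t, latticePoint t ∈ A N → t ∈ N
  have hgc : Continuous fun x : S => gradient f x.1 :=
    continuousOn_iff_continuous_domRestrict.1 (hcont.mono fun x hx => hx.1)
  have hTclosed : ∀ N, IsClosed (T N) := by
    intro N
    refine ((isClosed_latticeHull N).preimage continuous_subtype_val).inter ?_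
    have : {x : S | ∀ t ∈ N, inner ℝ (gradient f x.1) (latticePoint t) =
        inner ℝ (gradient f x.1) x.1} = ⋂ t ∈ (N : Set (Fin n → Fin (k + 1))),
        {x : S | inner ℝ (gradient f x.1) (latticePoint t) = inner ℝ (gradient f x.1) x.1} := by
      ext x
      simp
    change IsClosed {x : S | ∀ t ∈ N, inner ℝ (gradient f x.1) (latticePoint t) =
        inner ℝ (gradient f x.1) x.1}
    rw [this]
    exact isClosed_biInter fun t _ => isClosed_eq (hgc.inner continuous_const)
      (hgc.inner continuous_subtype_val)
  have hTA : ∀ N, ∀ x ∈ T N, (∃ p, affineSpan ℝ (insert p (A N : Set (EPoint n k))) = ⊤) →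
      (A N : Set (EPoint n k)) =
        {y | (innerₛₗ ℝ (gradient f x.1)) y = inner ℝ (gradient f x.1) x.1} := by
    rintro N x hx ⟨p, hp⟩
    refine eq_hyperplane_of_affineSpan_insert_eq_top hp ⟨x.1, hhull N hx.1⟩ ?_ fun y hy => ?_
    · intro h
      have := LinearMap.congr_fun h (gradient f x.1)
      exact hgrad x.1 x.2.1 (by simpa using this)
    · refine affineSpan_induction (p := fun y => innerₛₗ ℝ (gradient f x.1) y =
        inner ℝ (gradient f x.1) x.1) hy ?_ ?_
      · rintro _ ⟨t, ht, rfl⟩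
        exact hx.2 t ht
      · intro c u v w hu hv hw
        simp_all
  have hTdisj : ∀ M ∈ F, ∀ N ∈ F, ∀ x ∈ T M, x ∈ T N → M ⊆ N := by
    intro M hM N hN x hxM hxN t ht
    have hAA : (A M : Set (EPoint n k)) = A N := by
      rw [hTA M x hxM (Finset.mem_filter.1 hM).2.1, hTA N x hxN (Finset.mem_filter.1 hN).2.1]
    refine (Finset.mem_filter.1 hN).2.2 t ?_
    have : latticePoint t ∈ (A M : Set (EPoint n k)) := hLA M t ht
    rwa [hAA] at this
  have hgood : ∀ x : S, (∀ N, x.1 ∈ A N →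
      ∃ p, affineSpan ℝ (insert p (A N : Set (EPoint n k))) = ⊤) → ∃ N ∈ F, x ∈ T N := by
    intro x hx
    obtain ⟨M, hxM, hM⟩ := hsupp x.1 x.2.1 x.2.2
    -- Saturating `M` changes neither its span nor the tangency condition.
    let N : Finset (Fin n → Fin (k + 1)) := Finset.univ.filter fun t => latticePoint t ∈ A M
    have hMN : M ⊆ N := fun t ht => Finset.mem_filter.2 ⟨Finset.mem_univ _, hLA M t ht⟩
    have hNM : A N = A M := by
      refine le_antisymm (affineSpan_le.2 ?_) (affineSpan_mono ℝ (Set.image_mono hMN))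
      rintro _ ⟨t, ht, rfl⟩
      exact (Finset.mem_filter.1 ht).2
    have hMp := hx M (hhull M hxM)
    refine ⟨N, Finset.mem_filter.2 ⟨Finset.mem_univ _, hNM ▸ hMp, fun t ht => ?_⟩, ?_, fun t ht => ?_⟩
    · exact Finset.mem_filter.2 ⟨Finset.mem_univ _, hNM ▸ ht⟩
    · rw [latticeHull_eq_convexHull] at hxM ⊢
      exact convexHull_mono (Set.image_mono hMN) hxM
    · have hAM := hTA M x ⟨hxM, hM⟩ hMp
      have : latticePoint t ∈ (A M : Set (EPoint n k)) := (Finset.mem_filter.1 ht).2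
      rw [hAM] at this
      exact this
  have hcover : ∀ x : S, ∃ N ∈ F, x ∈ T N := by
    have hclosed : IsClosed (⋃ N ∈ F, T N) := F.finite_toSet.isClosed_biUnion fun N _ => hTclosed N
    intro x
    suffices x ∈ closure (⋃ N ∈ F, T N) by
      rw [hclosed.closure_eq] at this
      simpa using this
    rw [mem_closure_iff_nhds]
    intro W hW
    obtain ⟨V, hV, hVW⟩ := mem_nhds_subtype _ _ _ |>.1 hW
    let s : Finset (Finset (Fin n → Fin (k + 1))) := Finset.univ.filter fun N =>
      ∀ p, affineSpan ℝ (insert p (A N : Set (EPoint n k))) ≠ ⊤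
    obtain ⟨y, ⟨hyV, hyU⟩, hy0, hy⟩ := exists_zero_notMem_of_gradient_ne_zero s A
      (fun N hN => (Finset.mem_filter.1 hN).2) hU hdiff.continuousOn x.2.1 x.2.2
      (hgrad x.1 x.2.1) hV
    refine ⟨⟨y, hyU, hy0⟩, hVW hyV, ?_⟩
    have := hgood ⟨y, hyU, hy0⟩ fun N hN => by
      by_contra! h
      exact hy N (Finset.mem_filter.2 ⟨Finset.mem_univ _, h⟩) hN
    simpa using this
  obtain ⟨N, hN, hxN⟩ := hcover ⟨x₁, hx₁⟩
  have : PreconnectedSpace S := isPreconnected_iff_preconnectedSpace.1 hconn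
  have hclopen : IsClopen (T N) := by
    refine ⟨hTclosed N, ?_⟩
    have : (T N)ᶜ = ⋃ M ∈ F.erase N, T M := by
      ext x
      simp only [Set.mem_compl_iff, Set.mem_iUnion, Finset.mem_erase, exists_prop]
      constructor
      · intro hx
        obtain ⟨M, hM, hxM⟩ := hcover x
        exact ⟨M, ⟨fun h => hx (h ▸ hxM), hM⟩, hxM⟩
      · rintro ⟨M, ⟨hne, hM⟩, hxM⟩ hx
        exact hne ((hTdisj M hM N hN x hxM hx).antisymm (hTdisj N hN M hM x hx hxM))
    rw [← isClosed_compl_iff, this]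
    exact (F.erase N).finite_toSet.isClosed_biUnion fun M _ => hTclosed M
  have huniv := hclopen.eq_univ ⟨_, hxN⟩
  refine ⟨N, ⟨_, _, ?_, (congrArg _ (affineSpan_latticeHull N)).trans
    (hTA N _ hxN (Finset.mem_filter.1 hN).2.1)⟩, fun x hx => ?_⟩
  · intro h
    have := LinearMap.congr_fun h (gradient f x₁)
    exact hgrad x₁ hx₁.1 (by simpa using this)
  · have : (⟨x, hx⟩ : S) ∈ T N := huniv ▸ Set.mem_univ _
    exact this.1

/-! ### Reduced density matrices and local operations -/

/-- Exchanging `m` with the `b`-th entry of `t` is an involution on pairs. The lemma trades partial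
sums for sums over all tuples, at the cost of a factor `d = k + 1`. -/
theorem sum_sum_update (b : Fin n) (F : (Fin n → Fin (k + 1)) → ℂ) :
    ∑ t, ∑ m, F (Function.update t b m) = (k + 1) * ∑ t, F t := by
  let e : (Fin n → Fin (k + 1)) × Fin (k + 1) ≃ (Fin n → Fin (k + 1)) × Fin (k + 1) :=
    { toFun := fun p => (Function.update p.1 b p.2, p.1 b)
      invFun := fun p => (Function.update p.1 b p.2, p.1 b)
      left_inv := fun p => by simp
      right_inv := fun p => by simp }
  rw [← Fintype.sum_prod_type' (fun t m => F (Function.update t b m)),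
    ← e.sum_comp, Fintype.sum_prod_type]
  simp [e, Finset.mul_sum]

theorem mul_rdm_apply (c : Coeffs n k) (a : Fin n) (i i' : Fin (k + 1)) :
    (k + 1) * rdm c a i i' =
      ∑ t, c (Function.update t a i) * star (c (Function.update t a i')) := by
  simp only [rdm, Matrix.of_apply, Finset.sum_filter]
  rw [← sum_sum_update a]
  simp

theorem natCast_succ_ne_zero (k : ℕ) : (k + 1 : ℂ) ≠ 0 := by exact_mod_cast k.succ_ne_zero

theorem isHermitian_rdm (c : Coeffs n k) (a : Fin n) : (rdm c a).IsHermitian := by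
  ext i j
  apply mul_left_cancel₀ (natCast_succ_ne_zero k)
  rw [mul_rdm_apply, Matrix.conjTranspose_apply]
  have h := congrArg star (mul_rdm_apply c a j i)
  simp only [star_mul', star_add, star_natCast, star_one, star_sum, star_star] at h
  rw [h]
  exact Finset.sum_congr rfl fun t _ => mul_comm _ _

theorem trace_rdm (c : Coeffs n k) (a : Fin n) :
    (rdm c a).trace = ((∑ t, ‖c t‖ ^ 2 : ℝ) : ℂ) := by
  simp only [Matrix.trace, Matrix.diag_apply, rdm, Matrix.of_apply]
  rw [← Finset.sum_fiberwise (g := fun t : Fin n → Fin (k + 1) => t a), Complex.ofReal_sum]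
  refine Finset.sum_congr rfl fun i _ => ?_
  push_cast
  refine Finset.sum_congr rfl fun t ht => ?_
  obtain rfl := (Finset.mem_filter.1 ht).2
  simp [Complex.mul_conj']

theorem isState_iff_trace_rdm (c : Coeffs n k) (a : Fin n) :
    IsState c ↔ (rdm c a).trace = 1 := by
  rw [trace_rdm, IsState]
  exact_mod_cast Iff.rfl

/-- The action of a matrix on the `b`-th qudit. -/
def applyAt (W : Matrix (Fin (k + 1)) (Fin (k + 1)) ℂ) (b : Fin n) (c : Coeffs n k) : Coeffs n k :=
  fun t => ∑ j, W (t b) j * c (Function.update t b j)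

theorem applyAt_update (W : Matrix (Fin (k + 1)) (Fin (k + 1)) ℂ) (b : Fin n) (c : Coeffs n k)
    (t : Fin n → Fin (k + 1)) (m : Fin (k + 1)) :
    applyAt W b c (Function.update t b m) = (W.mulVec fun j => c (Function.update t b j)) m := by
  simp [applyAt, Matrix.mulVec, dotProduct]

theorem rdm_applyAt_self (W : Matrix (Fin (k + 1)) (Fin (k + 1)) ℂ) (b : Fin n)
    (c : Coeffs n k) : rdm (applyAt W b c) b = W * rdm c b * W.conjTranspose := by
  ext i i'
  apply mul_left_cancel₀ (natCast_succ_ne_zero k)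
  rw [mul_rdm_apply]
  simp only [applyAt_update, Matrix.mulVec, dotProduct, Matrix.mul_apply, star_sum, star_mul',
    Matrix.conjTranspose_apply, Finset.sum_mul, Finset.mul_sum]
  rw [Finset.sum_comm]
  refine (Finset.sum_congr rfl fun j' _ => Finset.sum_comm).trans ?_
  refine Finset.sum_congr rfl fun j _ => Finset.sum_congr rfl fun j' _ => ?_
  rw [show (k + 1 : ℂ) * (W i j' * rdm c b j' j * star (W i' j)) =
    W i j' * star (W i' j) * ((k + 1) * rdm c b j' j) by ring, mul_rdm_apply, Finset.mul_sum]
  exact Finset.sum_congr rfl fun t _ => by ring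

theorem mulVec_dotProduct_star_mulVec {W : Matrix (Fin (k + 1)) (Fin (k + 1)) ℂ}
    (hW : W.conjTranspose * W = 1) (v w : Fin (k + 1) → ℂ) :
    W.mulVec v ⬝ᵥ star (W.mulVec w) = v ⬝ᵥ star w := by
  rw [Matrix.star_mulVec, dotProduct_comm, Matrix.dotProduct_mulVec, Matrix.vecMul_vecMul, hW,
    Matrix.vecMul_one, dotProduct_comm]

/-- For fixed other indices, the sum over the `b`-th index is an inner product of two slices, which
`W` preserves. -/
theorem rdm_applyAt_of_ne {W : Matrix (Fin (k + 1)) (Fin (k + 1)) ℂ}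
    (hW : W.conjTranspose * W = 1) {a b : Fin n} (hab : a ≠ b) (c : Coeffs n k) :
    rdm (applyAt W b c) a = rdm c a := by
  ext i i'
  apply mul_left_cancel₀ (natCast_succ_ne_zero k)
  apply mul_left_cancel₀ (natCast_succ_ne_zero k)
  rw [mul_rdm_apply, mul_rdm_apply, ← sum_sum_update b, ← sum_sum_update b]
  refine Finset.sum_congr rfl fun t _ => ?_
  simp only [Function.update_comm hab.symm, applyAt_update]
  exact mulVec_dotProduct_star_mulVec hW _ _

/-- Hermitian matrices with the same characteristic polynomial are unitarily equivalent. -/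
theorem exists_conj_eq_of_charpoly_eq {A B : Matrix (Fin (k + 1)) (Fin (k + 1)) ℂ}
    (hA : A.IsHermitian) (hB : B.IsHermitian) (h : A.charpoly = B.charpoly) :
    ∃ W : Matrix (Fin (k + 1)) (Fin (k + 1)) ℂ, W.conjTranspose * W = 1 ∧
      W * A * W.conjTranspose = B := by
  have he := (hA.eigenvalues_eq_eigenvalues_iff hB).2 h
  have h1 := hA.conjStarAlgAut_star_eigenvectorUnitary
  have h2 := hB.spectral_theorem
  rw [← he, ← h1] at h2
  -- Pass to an eigenbasis of `A`, then leave by one of `B`; the diagonal forms agree by `he`.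
  let u := hB.eigenvectorUnitary * star hA.eigenvectorUnitary
  refine ⟨u, ?_, ?_⟩
  · exact Unitary.coe_star_mul_self u
  · rw [h2, Unitary.conjStarAlgAut_apply, Unitary.conjStarAlgAut_apply,
      ← Matrix.star_eq_conjTranspose]
    simp [u, mul_assoc]

/-- A realisable point is realised by a state whose reduced density matrices are diagonal. -/
theorem EPoint.Realisable.exists_rdm_eq_diagonal {lam : EPoint n k} (h : lam.Realisable) :
    ∃ c : Coeffs n k, IsState c ∧
      ∀ a, rdm c a = Matrix.diagonal fun i => ((lam.eig a i : ℝ) : ℂ) := by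
  classical
  suffices H : ∀ s : Finset (Fin n), ∃ c : Coeffs n k, IsState c ∧
      (∀ a ∈ s, rdm c a = Matrix.diagonal fun i => ((lam.eig a i : ℝ) : ℂ)) ∧
      ∀ a, (rdm c a).charpoly = ∏ i, (X - C ((lam.eig a i : ℝ) : ℂ)) by
    obtain ⟨c, hc, hd, -⟩ := H Finset.univ
    exact ⟨c, hc, fun a => hd a (Finset.mem_univ a)⟩
  intro s
  -- Diagonalise one qudit at a time; a unitary on one leaves the other reduced matrices unchanged.
  induction s using Finset.induction_on with
  | empty =>
    obtain ⟨c, hc, hch⟩ := h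
    exact ⟨c, hc, by simp, fun a => (hch a).2⟩
  | insert b s hb ih =>
    obtain ⟨c, hc, hd, hch⟩ := ih
    obtain ⟨W, hW, hWd⟩ := exists_conj_eq_of_charpoly_eq (isHermitian_rdm c b)
      (B := Matrix.diagonal fun i => ((lam.eig b i : ℝ) : ℂ))
      (by simp [Matrix.isHermitian_diagonal_iff, isSelfAdjoint_iff])
      (by rw [hch b, Matrix.charpoly_diagonal])
    have hself : rdm (applyAt W b c) b = Matrix.diagonal fun i => ((lam.eig b i : ℝ) : ℂ) := by
      rw [rdm_applyAt_self, hWd]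
    refine ⟨applyAt W b c, ?_, fun a ha => ?_, fun a => ?_⟩
    · rw [isState_iff_trace_rdm _ b, rdm_applyAt_self, Matrix.trace_mul_comm, ← mul_assoc, hW,
        one_mul, ← isState_iff_trace_rdm]
      exact hc
    · rcases eq_or_ne a b with rfl | hab
      · exact hself
      · rw [rdm_applyAt_of_ne hW hab]
        exact hd a ((Finset.mem_insert.1 ha).resolve_left hab)
    · rcases eq_or_ne a b with rfl | hab
      · rw [hself, Matrix.charpoly_diagonal]
      · rw [rdm_applyAt_of_ne hW hab, hch]

/-! ### First-order perturbation of eigenvalues -/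

/-- A nonidentity permutation moves at least two indices, so after one factor is differentiated a
vanishing off-diagonal factor remains. -/
theorem hasDerivAt_det_of_eq_diagonal {ι : Type*} [Fintype ι] [DecidableEq ι]
    {M : ℝ → Matrix ι ι ℂ} {M' : Matrix ι ι ℂ} {v : ι → ℂ} {x : ℝ}
    (hM : ∀ i j, HasDerivAt (fun s => M s i j) (M' i j) x) (hx : M x = Matrix.diagonal v) :
    HasDerivAt (fun s => (M s).det) (∑ i, (∏ j ∈ Finset.univ.erase i, v j) * M' i i) x := by
  simp only [Matrix.det_apply']
  have h := HasDerivAt.fun_sum (u := Finset.univ) fun (σ : Equiv.Perm ι) _ =>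
    (HasDerivAt.fun_finsetProd (u := Finset.univ) fun i _ => hM (σ i) i).const_mul
      (((Equiv.Perm.sign σ : ℤˣ) : ℤ) : ℂ)
  refine h.congr_deriv ?_
  rw [Finset.sum_eq_single (1 : Equiv.Perm ι)]
  · simp [hx]
  · intro σ _ hσ
    refine mul_eq_zero_of_right _ (Finset.sum_eq_zero fun i _ => ?_)
    obtain ⟨j, hji, hj⟩ : ∃ j, j ≠ i ∧ σ j ≠ j := by
      by_contra! hfix
      apply hσ
      ext j
      rcases eq_or_ne j i with rfl | hji
      · by_contra hj
        exact hj (σ.injective (hfix _ hj))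
      · exact hfix j hji
    rw [Finset.prod_eq_zero (Finset.mem_erase.2 ⟨hji, Finset.mem_univ j⟩) (by simp [hx, hj]),
      zero_smul]
  · simp

/-- Distinct roots split off `k` linear factors, and the trace fixes the remaining one. Hence only
the `d - 1` free coordinates need an equation. -/
theorem charpoly_eq_prod_of_eval_eq_zero {M : Matrix (Fin (k + 1)) (Fin (k + 1)) ℂ}
    {x : Fin (k + 1) → ℂ} (hx : Function.Injective x)
    (hroot : ∀ i : Fin k, M.charpoly.eval (x i.castSucc) = 0) (htr : M.trace = ∑ i, x i) :
    M.charpoly = ∏ i, (X - C (x i)) := by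
  have hdvd : ∏ i : Fin k, (X - C (x i.castSucc)) ∣ M.charpoly := by
    refine Finset.prod_dvd_of_coprime (fun i _ j _ hij => ?_) fun i _ =>
      dvd_iff_isRoot.2 (hroot i)
    exact isCoprime_X_sub_C_of_isUnit_sub
      (sub_ne_zero.2 fun h => hij (Fin.castSucc_injective k (hx h))).isUnit
  obtain ⟨q, hq⟩ := hdvd
  have hP : (∏ i : Fin k, (X - C (x i.castSucc))).Monic := monic_prod_X_sub_C _ _
  have hqm : q.Monic := hP.of_mul_monic_left (hq ▸ M.charpoly_monic)
  have hdeg : q.natDegree = 1 := by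
    have := congrArg natDegree hq
    rw [hP.natDegree_mul hqm, M.charpoly_natDegree_eq_dim, natDegree_finsetProd_X_sub_C_eq_card] at this
    simp at this
    omega
  have hqX := hqm.eq_X_add_C hdeg
  have hn : q.nextCoeff = q.coeff 0 := by simp [nextCoeff, hdeg]
  have htr' := M.trace_eq_neg_charpoly_nextCoeff
  rw [hq, hP.nextCoeff_mul hqm, prod_X_sub_C_nextCoeff, hn, htr, Fin.sum_univ_castSucc] at htr'
  have hq0 : q.coeff 0 = - x (Fin.last k) := by linear_combination htr'
  rw [hq, Fin.prod_univ_castSucc, hqX, hq0]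
  simp [sub_eq_add_neg]

/-- This lets the eigenvalue constraints be real equations, as real Lagrange multipliers require. -/
theorem im_eval_charpoly_eq_zero {M : Matrix (Fin (k + 1)) (Fin (k + 1)) ℂ}
    (hM : M.IsHermitian) (x : ℝ) : (M.charpoly.eval (x : ℂ)).im = 0 := by
  rw [← Complex.conj_eq_iff_im, Matrix.eval_charpoly, starRingEnd_apply,
    ← Matrix.det_conjTranspose, Matrix.conjTranspose_sub, hM.eq]
  congr 2
  simp [Matrix.scalar_apply, Matrix.diagonal_conjTranspose]

theorem EPoint.sum_eig (lam : EPoint n k) (a : Fin n) : ∑ i, lam.eig a i = 1 := by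
  simp [EPoint.eig, Fin.sum_univ_castSucc]

@[simp]
theorem EPoint.eig_castSucc (lam : EPoint n k) (a : Fin n) (i : Fin k) :
    lam.eig a i.castSucc = lam (a, i) := by
  simp [EPoint.eig]

theorem EPoint.continuous_eig (a : Fin n) (i : Fin (k + 1)) :
    Continuous fun lam : EPoint n k => lam.eig a i := by
  induction i using Fin.lastCases with
  | last => simpa [EPoint.eig] using by fun_prop
  | cast i => simpa using by fun_prop

theorem EPoint.eventually_strictMono_eig {lam : EPoint n k} (h : ∀ a, StrictMono (lam.eig a)) :
    ∀ᶠ x : EPoint n k in nhds lam, ∀ a, StrictMono (x.eig a) := by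
  refine Filter.eventually_all.2 fun a => ?_
  have : ∀ᶠ x : EPoint n k in nhds lam, ∀ i j, i < j → x.eig a i < x.eig a j :=
    Filter.eventually_all.2 fun i => Filter.eventually_all.2 fun j =>
      Filter.eventually_imp_distrib_left.2 fun hij =>
        (EPoint.continuous_eig a i).continuousAt.eventually_lt
          (EPoint.continuous_eig a j).continuousAt (h a hij)
  filter_upwards [this] with x hx i j hij using hx i j hij

theorem EPoint.realisable_of_eval_charpoly {lam : EPoint n k} (hmono : ∀ a, StrictMono (lam.eig a))
    {c : Coeffs n k} (hc : IsState c)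
    (h : ∀ p : Fin n × Fin k, ((rdm c p.1).charpoly.eval ((lam p : ℝ) : ℂ)).re = 0) :
    lam.Realisable := by
  refine ⟨c, hc, fun a => ⟨(hmono a).monotone, ?_⟩⟩
  refine charpoly_eq_prod_of_eval_eq_zero (Complex.ofReal_injective.comp (hmono a).injective)
    (fun i => ?_) ?_
  · rw [EPoint.eig_castSucc]
    exact Complex.ext (h (a, i)) (im_eval_charpoly_eq_zero (isHermitian_rdm c a) _)
  · rw [(isState_iff_trace_rdm c a).1 hc, ← Complex.ofReal_sum, EPoint.sum_eig, Complex.ofReal_one]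

/-- The vector with every coefficient multiplied by a real number. -/
def rescale (c : Coeffs n k) (r : (Fin n → Fin (k + 1)) → ℝ) : Coeffs n k :=
  fun t => (r t : ℂ) * c t

/-- The characteristic polynomial of the reduced density matrix of a rescaled vector, evaluated at
one coordinate of an eigenvalue point. -/
def charpolyAt (c : Coeffs n k) (p : Fin n × Fin k)
    (z : ((Fin n → Fin (k + 1)) → ℝ) × EPoint n k) : ℝ :=
  ((rdm (rescale c z.1) p.1).charpoly.eval ((z.2 p : ℝ) : ℂ)).re

theorem contDiff_charpolyAt (c : Coeffs n k) (p : Fin n × Fin k) :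
    ContDiff ℝ 1 (charpolyAt c p) := by
  unfold charpolyAt
  simp only [Matrix.eval_charpoly, Matrix.det_apply', rdm, rescale]
  refine Complex.reCLM.contDiff.comp (ContDiff.sum fun σ _ => contDiff_const.mul
    (contDiff_prod fun i _ => ?_))
  simp only [Matrix.sub_apply, Matrix.scalar_apply, Matrix.diagonal_apply, Matrix.of_apply]
  have hr : ∀ t, ContDiff ℝ 1 fun z : ((Fin n → Fin (k + 1)) → ℝ) × EPoint n k =>
      (z.1 t : ℂ) := fun t => Complex.ofRealCLM.contDiff.comp (by fun_prop)
  have hl : ContDiff ℝ 1 fun z : ((Fin n → Fin (k + 1)) → ℝ) × EPoint n k =>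
      ((z.2 p : ℝ) : ℂ) := Complex.ofRealCLM.contDiff.comp (by fun_prop)
  refine ContDiff.sub ?_ (ContDiff.sum fun t _ => ?_)
  · split_ifs
    · exact hl
    · exact contDiff_const
  · simp only [star_mul', Complex.star_def, Complex.conj_ofReal]
    exact ((hr _).mul contDiff_const).mul ((hr _).mul contDiff_const)

theorem rdm_apply_self (c : Coeffs n k) (a : Fin n) (i : Fin (k + 1)) :
    rdm c a i i = ((∑ t : Fin n → Fin (k + 1) with t a = i, ‖c t‖ ^ 2 : ℝ) : ℂ) := by
  simp only [rdm, Matrix.of_apply]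
  push_cast
  refine Finset.sum_congr rfl fun t ht => ?_
  obtain rfl := (Finset.mem_filter.1 ht).2
  simp [Complex.mul_conj']

/-- At a diagonal matrix only diagonal variations count to first order, and of these only the one at
the vanishing entry `p.2.castSucc`, since every other term keeps that zero as a factor. -/
theorem fderiv_charpolyAt {c : Coeffs n k} {lam : EPoint n k} {p : Fin n × Fin k}
    (hc : rdm c p.1 = Matrix.diagonal fun i => ((lam.eig p.1 i : ℝ) : ℂ))
    (v : (Fin n → Fin (k + 1)) → ℝ) (μ : EPoint n k) :
    fderiv ℝ (charpolyAt c p) (1, lam) (v, μ) =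
      (∏ j ∈ Finset.univ.erase p.2.castSucc, (lam p - lam.eig p.1 j)) *
        (μ p - 2 * ∑ t : Fin n → Fin (k + 1) with t p.1 = p.2.castSucc, v t * ‖c t‖ ^ 2) := by
  have h1 := ((contDiff_charpolyAt c p).differentiable one_ne_zero (1, lam)).hasFDerivAt.hasLineDerivAt
    (v, μ)
  refine HasDerivAt.unique h1 ?_
  simp only [charpolyAt, Matrix.eval_charpoly]
  have hr : ∀ t, HasDerivAt (fun s : ℝ => (((1 + s • v) t : ℝ) : ℂ)) (v t) 0 := fun t => by
    have : HasDerivAt (fun s : ℝ => (1 : ℝ) + s * v t) (v t) 0 := by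
      simpa using ((hasDerivAt_id (0 : ℝ)).mul_const (v t)).const_add 1
    simpa using this.ofReal_comp
  have hl : HasDerivAt (fun s : ℝ => (((lam + s • μ) p : ℝ) : ℂ)) (μ p) 0 := by
    have : HasDerivAt (fun s : ℝ => lam p + s * μ p) (μ p) 0 := by
      simpa using ((hasDerivAt_id (0 : ℝ)).mul_const (μ p)).const_add (lam p)
    simpa using this.ofReal_comp
  let D : Matrix (Fin (k + 1)) (Fin (k + 1)) ℂ := Matrix.of fun i j =>
    (if i = j then (μ p : ℂ) else 0) - ∑ t : Fin n → Fin (k + 1) with t p.1 = i,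
      ((v t : ℂ) * c t * star (c (Function.update t p.1 j)) +
        c t * (v (Function.update t p.1 j) * star (c (Function.update t p.1 j))))
  have hM : ∀ i j, HasDerivAt (fun s : ℝ => (Matrix.scalar (Fin (k + 1))
      (((lam + s • μ) p : ℝ) : ℂ) - rdm (rescale c (1 + s • v)) p.1) i j) (D i j) 0 := by
    intro i j
    simp only [Matrix.sub_apply, Matrix.scalar_apply, Matrix.diagonal_apply, rdm, rescale,
      Matrix.of_apply, D, star_mul', Complex.star_def, Complex.conj_ofReal]
    refine HasDerivAt.sub ?_ (HasDerivAt.fun_sum fun t _ => ?_)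
    · split_ifs
      · exact hl
      · exact hasDerivAt_const _ _
    · refine (((hr t).mul_const (c t)).mul ((hr (Function.update t p.1 j)).mul_const
        (star (c (Function.update t p.1 j))))).congr_deriv ?_
      simp
  have h0 : Matrix.scalar (Fin (k + 1)) (((lam + (0 : ℝ) • μ) p : ℝ) : ℂ) -
      rdm (rescale c (1 + (0 : ℝ) • v)) p.1 =
      Matrix.diagonal fun j => ((lam p - lam.eig p.1 j : ℝ) : ℂ) := by
    have : rescale c (1 + (0 : ℝ) • v) = c := by ext t; simp [rescale]
    rw [this, hc, Matrix.scalar_apply, Matrix.diagonal_sub]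
    simp
  have h2 := (hasDerivAt_det_of_eq_diagonal hM h0)
  have h3 := Complex.reCLM.hasFDerivAt.comp_hasDerivAt (0 : ℝ) h2
  refine h3.congr_deriv ?_
  rw [Finset.sum_eq_single p.2.castSucc]
  · have hD : D p.2.castSucc p.2.castSucc = ((μ p - 2 * ∑ t : Fin n → Fin (k + 1) with
        t p.1 = p.2.castSucc, v t * ‖c t‖ ^ 2 : ℝ) : ℂ) := by
      simp only [D, Matrix.of_apply, if_true]
      push_cast
      rw [Finset.mul_sum]
      congr 1
      refine Finset.sum_congr rfl fun t ht => ?_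
      rw [← (Finset.mem_filter.1 ht).2, Function.update_eq_self, ← Complex.mul_conj',
        Complex.star_def]
      ring
    rw [hD, ← Complex.ofReal_prod, ← Complex.ofReal_mul]
    exact Complex.ofReal_re _
  · intro i _ hi
    rw [Finset.prod_eq_zero (Finset.mem_erase.2 ⟨hi.symm, Finset.mem_univ _⟩) (by simp), zero_mul]
  · simp

/-! ### The stationarity condition -/

theorem eq_sum_smul_latticePoint {lam : EPoint n k} {c : Coeffs n k}
    (hd : ∀ a, rdm c a = Matrix.diagonal fun i => ((lam.eig a i : ℝ) : ℂ)) :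
    lam = ∑ t, ‖c t‖ ^ 2 • latticePoint t := by
  ext ⟨a, i⟩
  have h := congrFun (congrFun (hd a) i.castSucc) i.castSucc
  rw [rdm_apply_self, Matrix.diagonal_apply_eq, EPoint.eig_castSucc, Complex.ofReal_inj,
    Finset.sum_filter] at h
  simp [← h, latticePoint]

/-- At a point of a regular hypersurface that bounds the realisable points, the lattice points
occurring in a realising state lie in the tangent hyperplane. -/
theorem exists_mem_latticeHull_of_realisable_iff {U : Set (EPoint n k)} {f : EPoint n k → ℝ}
    (hU : IsOpen U) (hnondeg : ∀ lam ∈ U, lam.Nondegenerate)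
    (hreal : ∀ lam ∈ U, lam.Realisable ↔ 0 ≤ f lam) (hdiff : DifferentiableOn ℝ f U)
    (hcont : ContinuousOn (gradient f) U) {lam : EPoint n k} (hlam : lam ∈ U) (hf : f lam = 0) :
    ∃ N : Finset (Fin n → Fin (k + 1)), lam ∈ latticeHull N ∧
      ∀ t ∈ N, inner ℝ (gradient f lam) (latticePoint t) = inner ℝ (gradient f lam) lam := by
  classical
  have hlr := (hreal lam hlam).2 hf.ge
  have hmono : ∀ a, StrictMono (lam.eig a) := by
    obtain ⟨c, -, hc⟩ := hlr
    exact fun a => (hc a).1.strictMono_of_injective (hnondeg lam hlam a)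
  obtain ⟨c, hc, hd⟩ := hlr.exists_rdm_eq_diagonal
  have hsum := eq_sum_smul_latticePoint hd
  set g := gradient f lam
  let P : Fin n × Fin k → ℝ := fun p =>
    ∏ j ∈ Finset.univ.erase p.2.castSucc, (lam p - lam.eig p.1 j)
  have hP : ∀ p, P p ≠ 0 := fun p => Finset.prod_ne_zero_iff.2 fun j hj => by
    rw [← EPoint.eig_castSucc lam p.1 p.2, sub_ne_zero]
    exact fun h => (Finset.mem_erase.1 hj).1 ((hmono p.1).injective h).symm
  -- The constraints: `none` is normalisation, `some p` the eigenvalue equation for the coordinate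
  -- `p`.
  let G : Option (Fin n × Fin k) → ((Fin n → Fin (k + 1)) → ℝ) × EPoint n k → ℝ := fun o =>
    o.elim (fun z => ∑ t, (z.1 t) ^ 2 * ‖c t‖ ^ 2) (charpolyAt c)
  have hG : ∀ o, ContDiff ℝ 1 (G o) := by
    rintro (_ | p)
    · change ContDiff ℝ 1 fun z : ((Fin n → Fin (k + 1)) → ℝ) × EPoint n k =>
        ∑ t, (z.1 t) ^ 2 * ‖c t‖ ^ 2
      fun_prop
    · exact contDiff_charpolyAt c p
  have hG' : ∀ o, HasStrictFDerivAt (G o) (fderiv ℝ (G o) (1, lam)) (1, lam) := fun o =>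
    (hG o).contDiffAt.hasStrictFDerivAt one_ne_zero
  have hnone : ∀ v μ, fderiv ℝ (G none) (1, lam) (v, μ) = 2 * ∑ t, v t * ‖c t‖ ^ 2 := by
    intro v μ
    refine HasDerivAt.unique ((hG' none).hasFDerivAt.hasLineDerivAt (v, μ)) ?_
    have : HasDerivAt (fun s : ℝ => ∑ t, (1 + s * v t) ^ 2 * ‖c t‖ ^ 2)
        (∑ t, 2 * v t * ‖c t‖ ^ 2) 0 := by
      refine HasDerivAt.fun_sum fun t _ => HasDerivAt.mul_const ?_ _
      have h1 : HasDerivAt (fun s : ℝ => 1 + s * v t) (v t) 0 := by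
        simpa using ((hasDerivAt_id (0 : ℝ)).mul_const (v t)).const_add 1
      simpa using h1.fun_pow 2
    refine (this.congr_deriv ?_)
    rw [Finset.mul_sum]
    exact Finset.sum_congr rfl fun t _ => by ring
  have hstrict : HasStrictFDerivAt f (InnerProductSpace.toDual ℝ (EPoint n k) g) lam := by
    refine hasStrictFDerivAt_of_hasFDerivAt_of_continuousAt
      (f' := fun y => InnerProductSpace.toDual ℝ (EPoint n k) (gradient f y)) ?_ ?_
    · filter_upwards [hU.mem_nhds hlam] with y hy
      exact (hdiff.differentiableAt (hU.mem_nhds hy)).hasGradientAt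
    · exact (InnerProductSpace.toDual ℝ (EPoint n k)).continuous.continuousAt.comp
        (hcont.continuousAt (hU.mem_nhds hlam))
  have hφ : HasStrictFDerivAt
      (fun z : ((Fin n → Fin (k + 1)) → ℝ) × EPoint n k => f z.2)
      ((InnerProductSpace.toDual ℝ (EPoint n k) g).comp (ContinuousLinearMap.snd ℝ _ _))
      ((1 : (Fin n → Fin (k + 1)) → ℝ), lam) :=
    HasStrictFDerivAt.comp ((1 : (Fin n → Fin (k + 1)) → ℝ), lam) hstrict hasStrictFDerivAt_snd
  have hr1 : rescale c 1 = c := by ext t; simp [rescale]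
  have hG0 : ∀ p, G (some p) (1, lam) = 0 := by
    intro p
    change charpolyAt c p (1, lam) = 0
    simp only [charpolyAt, hr1]
    rw [hd, Matrix.charpoly_diagonal, eval_prod,
      Finset.prod_eq_zero (Finset.mem_univ p.2.castSucc) (by simp)]
    rfl
  have hextr : IsLocalExtrOn (fun z : ((Fin n → Fin (k + 1)) → ℝ) × EPoint n k => f z.2)
      {z | ∀ o, G o z = G o (1, lam)} (1, lam) := by
    refine Or.inl ?_
    have hev : ∀ᶠ z : ((Fin n → Fin (k + 1)) → ℝ) × EPoint n k in nhds (1, lam),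
        z.2 ∈ U ∧ ∀ a, StrictMono (z.2.eig a) :=
      (continuous_snd.tendsto ((1 : (Fin n → Fin (k + 1)) → ℝ), lam)).eventually
        ((hU.eventually_mem hlam).and (EPoint.eventually_strictMono_eig hmono))
    filter_upwards [nhdsWithin_le_nhds hev, self_mem_nhdsWithin] with z hz hzG
    change f lam ≤ f z.2
    rw [hf, ← hreal _ hz.1]
    refine EPoint.realisable_of_eval_charpoly hz.2 (c := rescale c z.1) ?_ fun p =>
      (hzG (some p)).trans (hG0 p)
    have h1 : ∑ t, (z.1 t) ^ 2 * ‖c t‖ ^ 2 = ∑ t, (1 : ℝ) ^ 2 * ‖c t‖ ^ 2 := hzG none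
    rw [IsState] at hc ⊢
    simpa [rescale, mul_pow, hc] using h1
  obtain ⟨Λ, Λ₀, hne, hΛ⟩ := hextr.exists_multipliers_of_hasStrictFDerivAt hG' hφ
  have hΛ' : ∀ (v : (Fin n → Fin (k + 1)) → ℝ) (μ : EPoint n k),
      Λ none * (2 * ∑ t, v t * ‖c t‖ ^ 2) + ∑ p, Λ (some p) * (P p *
      (μ p - 2 * ∑ t : Fin n → Fin (k + 1) with t p.1 = p.2.castSucc, v t * ‖c t‖ ^ 2)) +
      Λ₀ * inner ℝ g μ = 0 := by
    intro v μ
    have h := DFunLike.congr_fun hΛ (v, μ)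
    rw [Fintype.sum_option] at h
    have hsome : ∀ p, fderiv ℝ (G (some p)) (1, lam) (v, μ) = _ := fun p =>
      fderiv_charpolyAt (hd p.1) v μ
    simpa [hnone, hsome, P] using h
  -- Vary only the coordinate `p` of the eigenvalue point.
  have hlamP : ∀ p, Λ (some p) * P p = - (Λ₀ * g p) := by
    intro p
    have h := hΛ' 0 (EuclideanSpace.single p 1)
    simp [EuclideanSpace.inner_single_right] at h
    linarith
  have hL : ∀ t, (inner ℝ g (latticePoint t) : ℝ) =
      ∑ p : Fin n × Fin k, if t p.1 = p.2.castSucc then g p else 0 := by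
    intro t
    simp [PiLp.inner_apply, latticePoint]
  -- Vary only the factor `r t`, and eliminate the eigenvalue multipliers by `hlamP`.
  have hw : ∀ t, ‖c t‖ ^ 2 * (Λ none + Λ₀ * inner ℝ g (latticePoint t)) = 0 := by
    intro t
    have h := hΛ' (Pi.single t 1) 0
    have hs : ∀ p : Fin n × Fin k, ∑ u : Fin n → Fin (k + 1) with u p.1 = p.2.castSucc,
        (Pi.single t 1 : (Fin n → Fin (k + 1)) → ℝ) u * ‖c u‖ ^ 2 =
        if t p.1 = p.2.castSucc then ‖c t‖ ^ 2 else 0 := by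
      intro p
      rw [Finset.sum_filter, Finset.sum_eq_single t (fun u _ hu => by simp [hu]) (by simp)]
      simp
    have hterm : ∀ p : Fin n × Fin k, Λ (some p) * (P p * ((0 : EPoint n k) p -
        2 * if t p.1 = p.2.castSucc then ‖c t‖ ^ 2 else 0)) =
        2 * ‖c t‖ ^ 2 * Λ₀ * if t p.1 = p.2.castSucc then g p else 0 := by
      intro p
      split_ifs
      · rw [PiLp.zero_apply]
        linear_combination (-2 * ‖c t‖ ^ 2) * hlamP p
      · simp
    have hn : ∑ u, (Pi.single t 1 : (Fin n → Fin (k + 1)) → ℝ) u * ‖c u‖ ^ 2 = ‖c t‖ ^ 2 := by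
      rw [Finset.sum_eq_single t (fun u _ hu => by simp [hu]) (by simp)]
      simp
    simp only [hs, hterm, hn, inner_zero_right] at h
    rw [← Finset.mul_sum, ← hL] at h
    linear_combination h / 2
  -- If `Λ₀ = 0`, nondegeneracy (`hP`) kills the eigenvalue multipliers, so `Λ none ≠ 0` and `hw`
  -- forces `c = 0`.
  have hΛ₀ : Λ₀ ≠ 0 := by
    intro h0
    have hs : ∀ p, Λ (some p) = 0 := fun p => by
      have := hlamP p
      rw [h0, zero_mul, neg_zero] at this
      exact (mul_eq_zero.1 this).resolve_right (hP p)
    have hn : Λ none ≠ 0 := fun hn => hne (by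
      rw [Prod.mk_eq_zero]
      refine ⟨funext fun o => ?_, h0⟩
      cases o
      exacts [hn, hs _])
    have : ∑ t, ‖c t‖ ^ 2 = 0 := Finset.sum_eq_zero fun t _ => by
      have := hw t
      rw [h0, zero_mul, add_zero] at this
      exact (mul_eq_zero.1 this).resolve_right hn
    rw [IsState, this] at hc
    exact zero_ne_one hc
  have hval : ∀ t, c t ≠ 0 → (inner ℝ g (latticePoint t) : ℝ) = - Λ none / Λ₀ := by
    intro t ht
    have := (mul_eq_zero.1 (hw t)).resolve_left (by simpa using ht)
    rw [eq_div_iff hΛ₀]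
    linarith
  have hglam : (inner ℝ g lam : ℝ) = - Λ none / Λ₀ := by
    rw [hsum, inner_sum]
    rw [IsState] at hc
    rw [← one_mul (- Λ none / Λ₀), ← hc, Finset.sum_mul]
    refine Finset.sum_congr rfl fun t _ => ?_
    rw [inner_smul_right]
    by_cases ht : c t = 0
    · simp [ht]
    · rw [hval t ht]
  have hsupp : ∀ t, t ∉ Finset.univ.filter (fun t => c t ≠ 0) → c t = 0 := fun t ht => by
    simpa using ht
  refine ⟨Finset.univ.filter fun t => c t ≠ 0, ⟨fun t => ‖c t‖ ^ 2, fun t _ => ⟨by positivity, ?_⟩,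
    ?_, ?_⟩, fun t ht => ?_⟩
  · rw [IsState] at hc
    exact hc ▸ Finset.single_le_sum (f := fun u => ‖c u‖ ^ 2) (fun u _ => by positivity)
      (Finset.mem_univ t)
  · rw [Finset.sum_subset (Finset.subset_univ _) fun t _ ht => by simp [hsupp t ht]]
    exact hc
  · rw [Finset.sum_subset (Finset.subset_univ _) fun t _ ht => by simp [hsupp t ht]]
    exact hsum
  · rw [hglam, hval t (Finset.mem_filter.1 ht).2]

end Qudit

end

theorem mainTheorem5 (n k : ℕ) (U : Set (Qudit.EPoint n k)) (f : Qudit.EPoint n k → ℝ)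
    (hU : IsOpen U) (hUne : U.Nonempty)
    (hnondeg : ∀ lam ∈ U, lam.Nondegenerate)
    (hreal : ∀ lam ∈ U, lam.Realisable ↔ 0 ≤ f lam)
    (hdiff : DifferentiableOn ℝ f U)
    (hcont : ContinuousOn (gradient f) U)
    (hgrad : ∀ lam ∈ U, gradient f lam ≠ 0)
    (hconn : IsPreconnected {lam ∈ U | f lam = 0}) :
    ∃ N : Finset (Fin n → Fin (k + 1)),
      Qudit.IsHyperplane (affineSpan ℝ (Qudit.latticeHull N) : Set (Qudit.EPoint n k)) ∧
      {lam ∈ U | f lam = 0} ⊆ Qudit.latticeHull N := by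
  obtain ⟨x, hx⟩ := hUne
  -- A nonzero gradient rules out the zero-dimensional cases `n = 0` and `d = 1`.
  have : Nontrivial (Qudit.EPoint n k) := ⟨_, _, hgrad x hx⟩
  exact Qudit.exists_isHyperplane_of_mem_latticeHull hU hdiff hcont hgrad hconn fun _ hy hfy =>
    Qudit.exists_mem_latticeHull_of_realisable_iff hU hnondeg hreal hdiff hcont hy hfy
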